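/- Let $p(x,y)$ be a real polynomial in two variables, of odd total degree $d>1$, all of whose coefficients are nonnegative, and such that $p(x,y)=1$ for all real $x,y$ with $x+y=1$. Suppose that $p$ is sharp, that is, $d=2N-3$, where $N$ is the number of nonzero coefficients of $p$. Then $p$ has no adjacent terms: for all integers $j,k\ge 0$, at least two of the three monomials $x^{j+1}y^k$, $x^jy^{k+1}$ and $x^jy^k$ have coefficient zero in $p$. -/

import Mathlib

open MvPolynomial

/-- The coefficient of the monomial `x ^ a * y ^ b` in `p`, where `x = X 0` and `y = X 1`. -/
noncomputable def coeffXY (p : MvPolynomial (Fin 2) ℝ) (a b : ℕ) : ℝ :=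
  p.coeff (Finsupp.single 0 a + Finsupp.single 1 b)

/-- The set `H(2, d)` of real polynomials in two variables, of degree `d`, with nonnegative
coefficients, that equal `1` on the line `x + y = 1`. -/
structure MemH (d : ℕ) (p : MvPolynomial (Fin 2) ℝ) : Prop where
  totalDegree_eq : p.totalDegree = d
  coeff_nonneg : ∀ m : Fin 2 →₀ ℕ, 0 ≤ p.coeff m
  eval_eq_one : ∀ x y : ℝ, x + y = 1 → MvPolynomial.eval ![x, y] p = 1

/-- `p` is sharp: its degree `d` and its number `N` of nonzero coefficients satisfy
`d = 2 * N - 3` (as integers). -/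
def IsSharp (p : MvPolynomial (Fin 2) ℝ) : Prop :=
  (p.totalDegree : ℤ) = 2 * (p.support.card : ℤ) - 3

/-! Write `p - 1 = (x + y - 1) q` and `d = m + 2`. An interior coefficient of `p` is `Q a (b + 1) +
Q (a + 1) b - Q (a + 1) (b + 1)`. At a node, where the first two have one sign and the third the
opposite sign, nothing cancels, so `p` has an exponent there; zeros of `q` can be signed so that
this stays true (`exists_signs`). Counting edges, every pattern that is `+1` on both axes has at
least `m + 1` nodes, those below the top side counted twice (`add_one_le_sum_node`). Each axis
carries a further exponent, so `2 * N ≥ m + 5`. Sharpness makes all of this an equality: the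
boundary keeps only its two top corners (`boundary_of_sharp`).

The count is valid for all values in `[-1, 1]`, not just signs. The nodes at the three exponents of
a small interior triangle share one value of the pattern. Replacing it by `0` makes each of them at
most `1 / 2`, so equality in the count leaves at most `3 / 2` exponents there, hence at most one
(`sum_supportIndicator_inner_le`). -/

/-! ### Sums over triangles -/

open Finset in
/-- The pairs of natural numbers with sum less than `n`. -/
def triangle (n : ℕ) : Finset (ℕ × ℕ) := (range n).biUnion HasAntidiagonal.antidiagonal

theorem mem_triangle {n : ℕ} {v : ℕ × ℕ} : v ∈ triangle n ↔ v.1 + v.2 < n := by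
  simp [triangle]

theorem sum_triangle_succ {M : Type*} [AddCommMonoid M] (n : ℕ) (f : ℕ → ℕ → M) :
    ∑ v ∈ triangle (n + 1), f v.1 v.2 =
      ∑ v ∈ triangle n, f v.1 v.2 + ∑ v ∈ Finset.HasAntidiagonal.antidiagonal n, f v.1 v.2 := by
  have h : triangle (n + 1) = triangle n ∪ Finset.HasAntidiagonal.antidiagonal n := by
    ext v
    simp only [Finset.mem_union, mem_triangle, Finset.HasAntidiagonal.mem_antidiagonal]
    omega
  rw [h, Finset.sum_union]
  rw [Finset.disjoint_left]
  intro v hv hv'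
  rw [mem_triangle] at hv
  rw [Finset.HasAntidiagonal.mem_antidiagonal] at hv'
  omega

theorem sum_triangle_succ_left {M : Type*} [AddCommMonoid M] (n : ℕ) (f : ℕ → ℕ → M) :
    ∑ v ∈ triangle (n + 1), f v.1 v.2 =
      ∑ v ∈ triangle n, f (v.1 + 1) v.2 + ∑ b ∈ Finset.range (n + 1), f 0 b := by
  induction n with
  | zero => simp [triangle]
  | succ n ih =>
    rw [sum_triangle_succ, ih, sum_triangle_succ n (fun a b => f (a + 1) b),
      Finset.sum_range_succ _ (n + 1),
      Finset.Nat.sum_antidiagonal_succ (f := fun v : ℕ × ℕ => f v.1 v.2)]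
    simp only
    abel

theorem sum_triangle_succ_right {M : Type*} [AddCommMonoid M] (n : ℕ) (f : ℕ → ℕ → M) :
    ∑ v ∈ triangle (n + 1), f v.1 v.2 =
      ∑ v ∈ triangle n, f v.1 (v.2 + 1) + ∑ a ∈ Finset.range (n + 1), f a 0 := by
  induction n with
  | zero => simp [triangle]
  | succ n ih =>
    rw [sum_triangle_succ, ih, sum_triangle_succ n (fun a b => f a (b + 1)),
      Finset.sum_range_succ _ (n + 1),
      Finset.Nat.sum_antidiagonal_succ' (f := fun v : ℕ × ℕ => f v.1 v.2)]
    simp only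
    abel

/-- A sum over a triangle, split into corner, sides and interior. -/
theorem sum_triangle_split (m : ℕ) (s : ℕ → ℕ → ℝ) :
    ∑ v ∈ triangle (m + 3), s v.1 v.2 =
      s 0 0 + ∑ a ∈ Finset.range (m + 2), s (a + 1) 0 + ∑ b ∈ Finset.range (m + 2), s 0 (b + 1)
      + ∑ v ∈ Finset.HasAntidiagonal.antidiagonal m, s (v.1 + 1) (v.2 + 1)
      + ∑ v ∈ triangle m, s (v.1 + 1) (v.2 + 1) := by
  rw [sum_triangle_succ_left (m + 2) s, sum_triangle_succ_right (m + 1) (fun a b => s (a + 1) b),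
    sum_triangle_succ m (fun a b => s (a + 1) (b + 1)), Finset.sum_range_succ' _ (m + 2)]
  ring

/-! ### Sign patterns and the node count -/

/-- The indicator of the support of a family of numbers. -/
noncomputable def supportIndicator (P : ℕ → ℕ → ℝ) (a b : ℕ) : ℝ := if P a b = 0 then 0 else 1

theorem supportIndicator_nonneg (P : ℕ → ℕ → ℝ) (a b : ℕ) : 0 ≤ supportIndicator P a b := by
  unfold supportIndicator
  split_ifs <;> norm_num

theorem supportIndicator_of_ne_zero {P : ℕ → ℕ → ℝ} {a b : ℕ} (h : P a b ≠ 0) :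
    supportIndicator P a b = 1 := if_neg h

theorem supportIndicator_of_eq_zero {P : ℕ → ℕ → ℝ} {a b : ℕ} (h : P a b = 0) :
    supportIndicator P a b = 0 := if_pos h

theorem eq_zero_of_supportIndicator_le_zero {P : ℕ → ℕ → ℝ} {a b : ℕ}
    (h : supportIndicator P a b ≤ 0) : P a b = 0 := by
  by_contra h0
  rw [supportIndicator_of_ne_zero h0] at h
  linarith

/-- For a sign pattern `σ`, the indicator that `σ` takes equal values at `(a, b + 1)` and
`(a + 1, b)` and the opposite value at `(a + 1, b + 1)`; affine in each value of `σ`. -/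
noncomputable def node (σ : ℕ → ℕ → ℝ) (a b : ℕ) : ℝ :=
  (1 - σ a (b + 1) * σ (a + 1) (b + 1) - σ (a + 1) b * σ (a + 1) (b + 1)
    + σ a (b + 1) * σ (a + 1) b) / 4

/-- For a sign pattern `σ`, the indicator that `σ` takes equal values at `(a, b + 1)` and
`(a + 1, b)`. -/
noncomputable def topNode (σ : ℕ → ℕ → ℝ) (a b : ℕ) : ℝ :=
  (1 + σ a (b + 1) * σ (a + 1) b) / 2

/-- The expression is affine in `x`, and at `x = 1` and `x = -1` it factors as `(1 - y) * (1 - z)`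
and `(1 + y) * (1 + z)`. -/
theorem one_sub_mul_sub_mul_add_mul_nonneg {x y z : ℝ} (hx : |x| ≤ 1) (hy : |y| ≤ 1)
    (hz : |z| ≤ 1) : 0 ≤ 1 - x * y - x * z + y * z := by
  rw [abs_le] at hx hy hz
  rcases le_total 0 (y + z) with h | h
  · nlinarith [mul_nonneg (sub_nonneg.2 hy.2) (sub_nonneg.2 hz.2)]
  · nlinarith [mul_nonneg (neg_le_iff_add_nonneg.1 hy.1) (neg_le_iff_add_nonneg.1 hz.1)]

/-- A lower bound for the number of nodes of a sign pattern on a triangle that is constant on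
two of its sides. -/
theorem add_one_le_sum_node (m : ℕ) (σ : ℕ → ℕ → ℝ) (hσ : ∀ a b, |σ a b| ≤ 1)
    (hx : ∀ a < m + 2, σ a 0 = 1) (hy : ∀ b < m + 2, σ 0 b = 1) :
    (m : ℝ) + 1 ≤ ∑ v ∈ Finset.HasAntidiagonal.antidiagonal m, topNode σ v.1 v.2
      + 2 * ∑ v ∈ triangle m, node σ v.1 v.2 := by
  -- Here the sum is over upright triangles, while nodes live on inverted ones. Every edge belongs
  -- to one of each kind, except the axis edges and the top edges, which give the bound.
  have hβ : 0 ≤ ∑ v ∈ triangle (m + 1), (1 - σ v.1 v.2 * σ (v.1 + 1) v.2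
      - σ v.1 v.2 * σ v.1 (v.2 + 1) + σ (v.1 + 1) v.2 * σ v.1 (v.2 + 1)) :=
    Finset.sum_nonneg fun v _ => one_sub_mul_sub_mul_add_mul_nonneg (hσ _ _) (hσ _ _) (hσ _ _)
  have hH := sum_triangle_succ_right m (fun a b => σ a b * σ (a + 1) b)
  have hV := sum_triangle_succ_left m (fun a b => σ a b * σ a (b + 1))
  have hD := sum_triangle_succ m (fun a b => σ (a + 1) b * σ a (b + 1))
  have h1 := sum_triangle_succ m (fun _ _ => (1 : ℝ))
  have hx' : ∑ a ∈ Finset.range (m + 1), σ a 0 * σ (a + 1) 0 = m + 1 := by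
    rw [Finset.sum_congr rfl (g := fun _ => (1 : ℝ))]
    · simp
    · intro a ha
      rw [Finset.mem_range] at ha
      rw [hx _ (by omega), hx _ (by omega), one_mul]
  have hy' : ∑ a ∈ Finset.range (m + 1), σ 0 a * σ 0 (a + 1) = m + 1 := by
    rw [Finset.sum_congr rfl (g := fun _ => (1 : ℝ))]
    · simp
    · intro a ha
      rw [Finset.mem_range] at ha
      rw [hy _ (by omega), hy _ (by omega), one_mul]
  have ht : ∑ v ∈ Finset.HasAntidiagonal.antidiagonal m, topNode σ v.1 v.2 =
      ((m + 1) + ∑ v ∈ Finset.HasAntidiagonal.antidiagonal m, σ (v.1 + 1) v.2 * σ v.1 (v.2 + 1)) / 2 := by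
    simp only [topNode]
    rw [← Finset.sum_div, Finset.sum_add_distrib]
    simp [mul_comm]
  have hn : ∑ v ∈ triangle m, node σ v.1 v.2 =
      (∑ v ∈ triangle m, (1 : ℝ) - ∑ v ∈ triangle m, σ v.1 (v.2 + 1) * σ (v.1 + 1) (v.2 + 1)
      - ∑ v ∈ triangle m, σ (v.1 + 1) v.2 * σ (v.1 + 1) (v.2 + 1)
      + ∑ v ∈ triangle m, σ (v.1 + 1) v.2 * σ v.1 (v.2 + 1)) / 4 := by
    simp only [node]
    rw [← Finset.sum_div, Finset.sum_add_distrib, Finset.sum_sub_distrib, Finset.sum_sub_distrib]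
    simp [mul_comm]
  have hc : ∑ v ∈ Finset.HasAntidiagonal.antidiagonal m, (1 : ℝ) = m + 1 := by simp
  rw [Finset.sum_add_distrib, Finset.sum_sub_distrib, Finset.sum_sub_distrib, hH, hV, hD, h1,
    hx', hy', hc] at hβ
  rw [ht, hn]
  linarith

/-! ### Signs of the coefficients of the quotient -/

/-- The coefficients `P` of a polynomial of degree `m + 2` and the coefficients `Q` of a
polynomial `q`, with `p - 1 = (x + y - 1) q`, apart from the constant coefficient of `p`. -/
structure IsQuotientPair (m : ℕ) (P Q : ℕ → ℕ → ℝ) : Prop where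
  nonneg : ∀ a b, 0 ≤ P a b
  left : ∀ a, P (a + 1) 0 = Q a 0 - Q (a + 1) 0
  right : ∀ b, P 0 (b + 1) = Q 0 b - Q 0 (b + 1)
  inner : ∀ a b, P (a + 1) (b + 1) = Q a (b + 1) + Q (a + 1) b - Q (a + 1) (b + 1)
  eq_zero : ∀ a b, m + 2 ≤ a + b → Q a b = 0
  exists_top : ∃ a b, a + b = m + 2 ∧ P a b ≠ 0

namespace IsQuotientPair

variable {m : ℕ} {P Q : ℕ → ℕ → ℝ}

theorem symm (h : IsQuotientPair m P Q) :
    IsQuotientPair m (fun a b => P b a) (fun a b => Q b a) where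
  nonneg a b := h.nonneg b a
  left := h.right
  right := h.left
  inner a b := by rw [h.inner]; ring
  eq_zero a b hab := h.eq_zero b a (by omega)
  exists_top := by
    obtain ⟨a, b, hab, hP⟩ := h.exists_top
    exact ⟨b, a, by omega, hP⟩

theorem left_nonneg (h : IsQuotientPair m P Q) (a : ℕ) : 0 ≤ Q a 0 := by
  have hanti : Antitone fun a => Q a 0 :=
    antitone_nat_of_succ_le fun a => by linarith [h.left a, h.nonneg (a + 1) 0]
  have := hanti (show a ≤ a + (m + 2) by omega)
  simp only at this
  rwa [h.eq_zero (a + (m + 2)) 0 (by omega)] at this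

theorem right_nonneg (h : IsQuotientPair m P Q) (b : ℕ) : 0 ≤ Q 0 b :=
  h.symm.left_nonneg b

theorem exists_pos_top (h : IsQuotientPair m P Q) : ∃ a b, a + b = m + 1 ∧ 0 < Q a b := by
  obtain ⟨a, b, hab, hP⟩ := h.exists_top
  have hP := (h.nonneg a b).lt_of_ne' hP
  rcases a with _ | a
  · obtain rfl : b = m + 1 + 1 := by omega
    exact ⟨0, m + 1, by omega, by linarith [h.right (m + 1), h.eq_zero 0 (m + 1 + 1) (by omega)]⟩
  · rcases b with _ | b
    · obtain rfl : a = m + 1 := by omega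
      exact ⟨m + 1, 0, by omega, by linarith [h.left (m + 1), h.eq_zero (m + 1 + 1) 0 (by omega)]⟩
    · rcases lt_or_ge 0 (Q a (b + 1)) with h' | h'
      · exact ⟨a, b + 1, by omega, h'⟩
      · exact ⟨a + 1, b, by omega,
          by linarith [h.inner a b, h.eq_zero (a + 1) (b + 1) (by omega)]⟩

/-- As `P a b ≥ 0`, a positive coefficient of `q` is at most the sum of its predecessors, so one of
these is positive. -/
theorem exists_pos_pred (h : IsQuotientPair m P Q) {a b n : ℕ} (hab : a + b = n + 1)
    (hQ : 0 < Q a b) : ∃ a' b', a' + b' = n ∧ 0 < Q a' b' := by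
  rcases a with _ | a
  · obtain rfl : b = n + 1 := by omega
    exact ⟨0, n, by omega, by linarith [h.right n, h.nonneg 0 (n + 1)]⟩
  · rcases b with _ | b
    · obtain rfl : a = n := by omega
      exact ⟨a, 0, by omega, by linarith [h.left a, h.nonneg (a + 1) 0]⟩
    · rcases lt_or_ge 0 (Q a (b + 1)) with h' | h'
      · exact ⟨a, b + 1, by omega, h'⟩
      · exact ⟨a + 1, b, by omega, by linarith [h.inner a b, h.nonneg (a + 1) (b + 1)]⟩

/-- `q` has a positive coefficient in every degree up to its own. -/
theorem exists_pos (h : IsQuotientPair m P Q) {n : ℕ} (hn : n ≤ m + 1) :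
    ∃ a ≤ n, 0 < Q a (n - a) := by
  suffices ∃ a b, a + b = n ∧ 0 < Q a b by
    obtain ⟨a, b, rfl, hQ⟩ := this
    exact ⟨a, by omega, by simpa using hQ⟩
  induction hn using Nat.decreasingInduction with
  | self => exact h.exists_pos_top
  | of_succ k _ ih =>
    obtain ⟨a, b, hab, hQ⟩ := ih
    exact h.exists_pos_pred hab hQ

theorem top_eq_add (h : IsQuotientPair m P Q) {a b : ℕ} (hab : a + b = m) :
    P (a + 1) (b + 1) = Q a (b + 1) + Q (a + 1) b := by
  rw [h.inner, h.eq_zero (a + 1) (b + 1) (by omega), sub_zero]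

/-- The coefficients of `q` have a sign pattern, in which zeros may have either sign, that is
positive on two sides of the triangle and all of whose nodes are exponents of `p`. -/
theorem exists_signs (h : IsQuotientPair m P Q) : ∃ σ : ℕ → ℕ → ℝ,
    (∀ a b, |σ a b| ≤ 1) ∧ (∀ a < m + 2, σ a 0 = 1) ∧ (∀ b < m + 2, σ 0 b = 1) ∧
    (∀ a b, a + b = m → topNode σ a b ≤ supportIndicator P (a + 1) (b + 1)) ∧
    (∀ a b, a + b < m → node σ a b ≤ supportIndicator P (a + 1) (b + 1)) := by
  obtain ⟨f, hpos⟩ : ∃ f : ℕ → ℕ, ∀ s ≤ m + 1, f s ≤ s ∧ 0 < Q (f s) (s - f s) := by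
    choose f hf using fun s : {s // s ≤ m + 1} => h.exists_pos s.2
    exact ⟨fun s => if hs : s ≤ m + 1 then f ⟨s, hs⟩ else 0, fun s hs => by
      simpa [hs] using hf ⟨s, hs⟩⟩
  -- Signs for zeros: in each degree they alternate, starting with `+1` at either axis. The two
  -- alternations can only clash at `f s`, where `q` has a positive coefficient and `τ` is not used.
  set τ : ℕ → ℕ → ℝ := fun a b => if a < f (a + b) then (-1) ^ a else (-1) ^ b with hτ
  set σ : ℕ → ℕ → ℝ := fun a b => if 0 < Q a b then 1 else if Q a b < 0 then -1 else τ a b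
    with hσ
  have hτ_sign : ∀ a b, τ a b = 1 ∨ τ a b = -1 := by
    intro a b
    simp only [hτ]
    split_ifs
    · exact neg_one_pow_eq_or ℝ a
    · exact neg_one_pow_eq_or ℝ b
  have hσ_sign : ∀ a b, (σ a b = 1 ∧ 0 ≤ Q a b) ∨ (σ a b = -1 ∧ Q a b ≤ 0) := by
    intro a b
    simp only [hσ]
    split_ifs with h1 h2
    · exact Or.inl ⟨rfl, h1.le⟩
    · exact Or.inr ⟨rfl, h2.le⟩
    · rcases hτ_sign a b with h3 | h3
      · exact Or.inl ⟨h3, not_lt.1 h2⟩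
      · exact Or.inr ⟨h3, not_lt.1 h1⟩
  have hσ_zero : ∀ a b, Q a b = 0 → σ a b = τ a b := by
    intro a b hab
    simp [hσ, hab]
  -- Adjacent zeros of one degree `s` lie on the same side of `f s`, hence get opposite signs.
  have hopp : ∀ a b, a + b ≤ m → Q a (b + 1) = 0 → Q (a + 1) b = 0 →
      σ a (b + 1) = -σ (a + 1) b := by
    intro a b hab h1 h2
    obtain ⟨hle, hp⟩ := hpos (a + b + 1) (by omega)
    have hne1 : f (a + b + 1) ≠ a := by
      intro hf
      rw [hf, show a + b + 1 - a = b + 1 by omega, h1] at hp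
      exact lt_irrefl _ hp
    have hne2 : f (a + b + 1) ≠ a + 1 := by
      intro hf
      rw [hf, show a + b + 1 - (a + 1) = b by omega, h2] at hp
      exact lt_irrefl _ hp
    rw [hσ_zero _ _ h1, hσ_zero _ _ h2]
    simp only [hτ, show a + (b + 1) = a + b + 1 by omega, show a + 1 + b = a + b + 1 by omega]
    rcases lt_or_ge (a + 1) (f (a + b + 1)) with h3 | h3
    · rw [if_pos (by omega), if_pos h3, pow_succ]
      ring
    · rw [if_neg (by omega), if_neg (by omega), pow_succ]
      ring
  refine ⟨σ, ?_, ?_, ?_, ?_, ?_⟩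
  · intro a b
    rcases hσ_sign a b with ⟨h1, -⟩ | ⟨h1, -⟩ <;> simp [h1]
  · intro a ha
    rcases (h.left_nonneg a).eq_or_lt' with h0 | h0
    · rw [hσ_zero _ _ h0]
      simp only [hτ, add_zero, pow_zero]
      rw [if_neg (hpos a (by omega)).1.not_gt]
    · simp [hσ, h0]
  · intro b hb
    rcases (h.right_nonneg b).eq_or_lt' with h0 | h0
    · rw [hσ_zero _ _ h0]
      obtain ⟨hle, hp⟩ := hpos b (by omega)
      have hne : 0 < f b := by
        rw [Nat.pos_iff_ne_zero]
        intro hf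
        rw [hf, Nat.sub_zero, h0] at hp
        exact lt_irrefl _ hp
      simp [hτ, hne]
    · simp [hσ, h0]
  · intro a b hab
    have hP := h.nonneg (a + 1) (b + 1)
    have hadd := h.top_eq_add hab
    have ho := hopp a b hab.le
    simp only [topNode, supportIndicator]
    -- At a node all terms of `hadd` have the same sign, so `P = 0` would make them all vanish, and
    -- `hopp` forbids equal signs at adjacent zeros. The same argument serves below the top side.
    rcases hσ_sign a (b + 1) with ⟨h1, h1'⟩ | ⟨h1, h1'⟩ <;>
    rcases hσ_sign (a + 1) b with ⟨h2, h2'⟩ | ⟨h2, h2'⟩ <;>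
    rw [h1, h2] at ho ⊢ <;> split_ifs with h0 <;> norm_num
    · have := ho (by linarith) (by linarith)
      norm_num at this
    · have := ho (by linarith) (by linarith)
      norm_num at this
  · intro a b hab
    have hP := h.nonneg (a + 1) (b + 1)
    have hadd := h.inner a b
    have ho := hopp a b hab.le
    simp only [node, supportIndicator]
    rcases hσ_sign a (b + 1) with ⟨h1, h1'⟩ | ⟨h1, h1'⟩ <;>
    rcases hσ_sign (a + 1) b with ⟨h2, h2'⟩ | ⟨h2, h2'⟩ <;>
    rcases hσ_sign (a + 1) (b + 1) with ⟨h3, h3'⟩ | ⟨h3, h3'⟩ <;>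
    rw [h1, h2] at ho <;> rw [h1, h2, h3] <;> split_ifs with h0 <;> norm_num
    · have := ho (by linarith) (by linarith)
      norm_num at this
    · have := ho (by linarith) (by linarith)
      norm_num at this

end IsQuotientPair

/-! ### Equality in the bound and its consequences -/

namespace IsQuotientPair

variable {m : ℕ} {P Q : ℕ → ℕ → ℝ}

/-- The coefficients of `p` along the axis telescope to `Q 0 0`, which is positive. -/
theorem one_le_sum_left (h : IsQuotientPair m P Q) :
    1 ≤ ∑ a ∈ Finset.range (m + 2), supportIndicator P (a + 1) 0 := by
  have h0 : 0 < Q 0 0 := by simpa using h.exists_pos (Nat.zero_le (m + 1))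
  obtain ⟨a, ha, hPa⟩ : ∃ a ∈ Finset.range (m + 2), P (a + 1) 0 ≠ 0 := by
    by_contra! hall
    have h1 : ∑ a ∈ Finset.range (m + 2), (Q a 0 - Q (a + 1) 0) = 0 :=
      Finset.sum_eq_zero fun a ha => by rw [← h.left, hall a ha]
    rw [Finset.sum_range_sub', h.eq_zero (m + 2) 0 (by omega)] at h1
    linarith
  rw [← supportIndicator_of_ne_zero hPa]
  exact Finset.single_le_sum (f := fun a => supportIndicator P (a + 1) 0)
    (fun _ _ => supportIndicator_nonneg _ _ _) ha

theorem one_le_sum_right (h : IsQuotientPair m P Q) :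
    1 ≤ ∑ b ∈ Finset.range (m + 2), supportIndicator P 0 (b + 1) :=
  h.symm.one_le_sum_left

/-- If `p` has no exponents inside the top side, then the top coefficients of `q` alternate,
so that `p` has the corner exponents. -/
theorem corner_ne_zero (h : IsQuotientPair m P Q)
    (htop : ∀ a b, a + b = m → P (a + 1) (b + 1) = 0) : P (m + 2) 0 ≠ 0 := by
  rw [h.left (m + 1), h.eq_zero (m + 1 + 1) 0 (by omega), sub_zero]
  intro h0
  have hall : ∀ b a, a + b = m + 1 → Q a b = 0 := by
    intro b
    induction b with
    | zero =>
      intro a ha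
      obtain rfl : a = m + 1 := by omega
      exact h0
    | succ b ih =>
      intro a ha
      have h1 := h.top_eq_add (a := a) (b := b) (by omega)
      rw [htop a b (by omega), ih (a + 1) (by omega)] at h1
      linarith
  obtain ⟨a, b, hab, hQ⟩ := h.exists_pos_top
  exact hQ.ne' (hall b a hab)

/-- For a sharp polynomial, the only exponents on the boundary are the two corners of top degree,
and the bound for the number of exponents inside is attained. -/
theorem boundary_of_sharp (h : IsQuotientPair m P Q)
    (hcard : 2 * ∑ v ∈ triangle (m + 3), supportIndicator P v.1 v.2 ≤ m + 5) :
    P 0 0 = 0 ∧ (∀ a < m + 1, P (a + 1) 0 = 0) ∧ (∀ b < m + 1, P 0 (b + 1) = 0) ∧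
    (∀ a b, a + b = m → P (a + 1) (b + 1) = 0) ∧
    2 * ∑ v ∈ triangle m, supportIndicator P (v.1 + 1) (v.2 + 1) ≤ m + 1 := by
  obtain ⟨σ, hσ, hx, hy, htop, hint⟩ := h.exists_signs
  have key := add_one_le_sum_node m σ hσ hx hy
  have htop' : ∑ v ∈ Finset.HasAntidiagonal.antidiagonal m, topNode σ v.1 v.2 ≤
      ∑ v ∈ Finset.HasAntidiagonal.antidiagonal m, supportIndicator P (v.1 + 1) (v.2 + 1) :=
    Finset.sum_le_sum fun v hv => htop _ _ (Finset.HasAntidiagonal.mem_antidiagonal.1 hv)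
  have hint' : ∑ v ∈ triangle m, node σ v.1 v.2 ≤
      ∑ v ∈ triangle m, supportIndicator P (v.1 + 1) (v.2 + 1) :=
    Finset.sum_le_sum fun v hv => hint _ _ (mem_triangle.1 hv)
  have hX := h.one_le_sum_left
  have hY := h.one_le_sum_right
  have h00 := supportIndicator_nonneg P 0 0
  have htop0 : 0 ≤ ∑ v ∈ Finset.HasAntidiagonal.antidiagonal m,
      supportIndicator P (v.1 + 1) (v.2 + 1) :=
    Finset.sum_nonneg fun _ _ => supportIndicator_nonneg _ _ _
  -- The lower bounds `1`, `1` for the axes and `key` already use up `m + 5`, so no slack remains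
  -- for the corner `(0, 0)`, the top side or further axis exponents.
  rw [sum_triangle_split] at hcard
  have htopP : ∀ a b, a + b = m → P (a + 1) (b + 1) = 0 := by
    intro a b hab
    apply eq_zero_of_supportIndicator_le_zero
    have := Finset.single_le_sum (s := Finset.HasAntidiagonal.antidiagonal m)
      (f := fun v : ℕ × ℕ => supportIndicator P (v.1 + 1) (v.2 + 1))
      (fun _ _ => supportIndicator_nonneg _ _ _)
      (Finset.HasAntidiagonal.mem_antidiagonal.2 hab : (a, b) ∈ _)
    simp only at this
    linarith
  have haxis : ∀ s : ℕ → ℝ, (∀ a, 0 ≤ s a) → s (m + 1) = 1 →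
      ∑ a ∈ Finset.range (m + 2), s a ≤ 1 → ∀ a < m + 1, s a ≤ 0 := by
    intro s hs h1 hsum a ha
    rw [Finset.sum_range_succ, h1] at hsum
    have := Finset.single_le_sum (fun a _ => hs a) (Finset.mem_range.2 ha)
    linarith
  refine ⟨eq_zero_of_supportIndicator_le_zero (by linarith), fun a ha => ?_, fun b hb => ?_,
    htopP, by linarith⟩
  · exact eq_zero_of_supportIndicator_le_zero (haxis (fun a => supportIndicator P (a + 1) 0)
      (fun _ => supportIndicator_nonneg _ _ _)
      (supportIndicator_of_ne_zero (h.corner_ne_zero htopP)) (by linarith) a ha)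
  · exact eq_zero_of_supportIndicator_le_zero (haxis (fun b => supportIndicator P 0 (b + 1))
      (fun _ => supportIndicator_nonneg _ _ _)
      (supportIndicator_of_ne_zero
        (h.symm.corner_ne_zero fun a b hab => htopP b a (by omega))) (by linarith) b hb)

/-- In the interior, a sharp polynomial has at most one exponent in each small triangle. -/
theorem sum_supportIndicator_inner_le (h : IsQuotientPair m P Q)
    (hcard : 2 * ∑ v ∈ triangle (m + 3), supportIndicator P v.1 v.2 ≤ m + 5) {a b : ℕ}
    (hab : a + b + 1 < m) :
    supportIndicator P (a + 1) (b + 1) + supportIndicator P (a + 2) (b + 1)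
      + supportIndicator P (a + 1) (b + 2) ≤ 3 / 2 := by
  obtain ⟨-, -, -, htopP, hsum⟩ := h.boundary_of_sharp hcard
  obtain ⟨σ, hσ, hx, hy, htop, hint⟩ := h.exists_signs
  -- The position `(a + 1, b + 1)` enters all three nodes of the small triangle, and lies off the
  -- axes and below the top side.
  set ρ : ℕ → ℕ → ℝ := fun i j => if i = a + 1 ∧ j = b + 1 then 0 else σ i j with hρ
  have hρσ : ∀ i j, ¬(i = a + 1 ∧ j = b + 1) → ρ i j = σ i j := fun i j hij => if_neg hij
  have hρ0 : ρ (a + 1) (b + 1) = 0 := if_pos ⟨rfl, rfl⟩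
  have hρ_abs : ∀ i j, |ρ i j| ≤ 1 := by
    intro i j
    simp only [hρ]
    split_ifs
    · simp
    · exact hσ i j
  have key := add_one_le_sum_node m ρ hρ_abs
    (fun i hi => by rw [hρσ _ _ (by omega), hx i hi])
    (fun j hj => by rw [hρσ _ _ (by omega), hy j hj])
  have htop' : ∑ v ∈ Finset.HasAntidiagonal.antidiagonal m, topNode ρ v.1 v.2 ≤ 0 := by
    refine Finset.sum_nonpos fun v hv => ?_
    have hv' := Finset.HasAntidiagonal.mem_antidiagonal.1 hv
    have := htop _ _ hv'
    rw [supportIndicator_of_eq_zero (htopP _ _ hv')] at this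
    rwa [topNode, hρσ _ _ (by omega), hρσ _ _ (by omega)]
  set A : Finset (ℕ × ℕ) := {(a, b), (a + 1, b), (a, b + 1)} with hA
  have hAsub : A ⊆ triangle m := by
    intro v hv
    simp only [hA, Finset.mem_insert, Finset.mem_singleton] at hv
    rw [mem_triangle]
    rcases hv with rfl | rfl | rfl <;> simp only <;> omega
  have hAsum : ∀ g : ℕ × ℕ → ℝ, ∑ v ∈ A, g v = g (a, b) + g (a + 1, b) + g (a, b + 1) := by
    intro g
    rw [hA, Finset.sum_insert (by simp), Finset.sum_insert (by simp), Finset.sum_singleton]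
    ring
  have hout : ∑ v ∈ triangle m \ A, node ρ v.1 v.2 ≤
      ∑ v ∈ triangle m \ A, supportIndicator P (v.1 + 1) (v.2 + 1) := by
    refine Finset.sum_le_sum fun v hv => ?_
    obtain ⟨i, j⟩ := v
    simp only [hA, Finset.mem_sdiff, mem_triangle, Finset.mem_insert, Finset.mem_singleton,
      Prod.mk.injEq] at hv
    have := hint i j hv.1
    simp only
    rwa [node, hρσ _ _ (by omega), hρσ _ _ (by omega), hρσ _ _ (by omega)]
  -- With the shared value `0`, each node is `(1 ± yz) / 4 ≤ 1 / 2`.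
  have hnode : ∑ v ∈ A, node ρ v.1 v.2 ≤ 3 / 2 := by
    have hmul : ∀ i j k l, ρ i j * ρ k l ≤ 1 := fun i j k l => by
      have := mul_le_one₀ (hρ_abs i j) (abs_nonneg (ρ k l)) (hρ_abs k l)
      rw [← abs_mul] at this
      exact (le_abs_self _).trans this
    have hmul' : ∀ i j k l, -1 ≤ ρ i j * ρ k l := fun i j k l => by
      have := mul_le_one₀ (hρ_abs i j) (abs_nonneg (ρ k l)) (hρ_abs k l)
      rw [← abs_mul] at this
      exact (abs_le.1 this).1
    rw [hAsum]
    simp only [node, hρ0]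
    linarith [hmul a (b + 1) (a + 1) b, hmul' (a + 2) b (a + 2) (b + 1),
      hmul' a (b + 2) (a + 1) (b + 2)]
  rw [← Finset.sum_sdiff hAsub] at key hsum
  rw [hAsum] at hsum
  simp only at hsum
  linarith

theorem pairwise_eq_zero (h : IsQuotientPair m P Q)
    (hcard : 2 * ∑ v ∈ triangle (m + 3), supportIndicator P v.1 v.2 ≤ m + 5) (j k : ℕ) :
    (P (j + 1) k = 0 ∧ P j (k + 1) = 0) ∨ (P (j + 1) k = 0 ∧ P j k = 0) ∨
    (P j (k + 1) = 0 ∧ P j k = 0) := by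
  obtain ⟨h00, hX, hY, htop, -⟩ := h.boundary_of_sharp hcard
  have hbig : ∀ a b, m + 2 < a + b → P a b = 0 := by
    intro a b hab
    rcases a with _ | a
    · rcases b with _ | b
      · exact h00
      · rw [h.right, h.eq_zero _ _ (by omega), h.eq_zero _ _ (by omega), sub_zero]
    · rcases b with _ | b
      · rw [h.left, h.eq_zero _ _ (by omega), h.eq_zero _ _ (by omega), sub_zero]
      · rw [h.inner, h.eq_zero _ _ (by omega), h.eq_zero _ _ (by omega),
          h.eq_zero _ _ (by omega)]
        ring
  have hX' : ∀ a < m + 2, P a 0 = 0 := by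
    rintro (_ | a) ha
    exacts [h00, hX a (by omega)]
  have hY' : ∀ b < m + 2, P 0 b = 0 := by
    rintro (_ | b) hb
    exacts [h00, hY b (by omega)]
  have htop' : ∀ a b, 0 < a → 0 < b → a + b = m + 2 → P a b = 0 := by
    rintro (_ | a) (_ | b) ha hb hab
    any_goals omega
    exact htop a b (by omega)
  -- Away from the interior, the only nonzero coefficients are the two top corners, which no small
  -- triangle contains together since `m + 2 > 1`.
  rcases Nat.lt_or_ge (m + 1) (j + k) with hjk | hjk
  · exact Or.inl ⟨hbig _ _ (by omega), hbig _ _ (by omega)⟩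
  rcases Nat.eq_zero_or_pos j with rfl | hj
  · have h1 := hY' k (by omega)
    rcases Nat.lt_or_ge k (m + 1) with hk | hk
    · exact Or.inr (Or.inr ⟨hY' (k + 1) (by omega), h1⟩)
    · exact Or.inr (Or.inl ⟨htop' _ _ (by omega) (by omega) (by omega), h1⟩)
  rcases Nat.eq_zero_or_pos k with rfl | hk
  · have h1 := hX' j (by omega)
    rcases Nat.lt_or_ge j (m + 1) with hj' | hj'
    · exact Or.inr (Or.inl ⟨hX' (j + 1) (by omega), h1⟩)
    · exact Or.inr (Or.inr ⟨htop' _ _ (by omega) (by omega) (by omega), h1⟩)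
  rcases Nat.lt_or_ge (j + k) (m + 1) with hjk' | hjk'
  · obtain ⟨a, rfl⟩ := Nat.exists_eq_add_of_lt hj
    obtain ⟨b, rfl⟩ := Nat.exists_eq_add_of_lt hk
    simp only [zero_add] at *
    -- Two exponents would give a sum of at least `2 > 3 / 2`.
    have := h.sum_supportIndicator_inner_le hcard (a := a) (b := b) (by omega)
    simp only [supportIndicator] at this
    by_cases h1 : P (a + 1 + 1) (b + 1) = 0 <;> by_cases h2 : P (a + 1) (b + 1 + 1) = 0 <;>
    by_cases h3 : P (a + 1) (b + 1) = 0 <;> simp_all <;> norm_num at this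
  · exact Or.inl ⟨htop' _ _ (by omega) (by omega) (by omega),
      htop' _ _ (by omega) (by omega) (by omega)⟩

end IsQuotientPair

/-! ### From polynomials to coefficient arrays -/

theorem sum_supportIndicator_coeffXY_le (p : MvPolynomial (Fin 2) ℝ) (F : Finset (ℕ × ℕ)) :
    ∑ v ∈ F, supportIndicator (coeffXY p) v.1 v.2 ≤ p.support.card := by
  classical
  have hinj : Function.Injective fun v : ℕ × ℕ =>
      (Finsupp.single 0 v.1 + Finsupp.single 1 v.2 : Fin 2 →₀ ℕ) := by
    intro v w hvw
    have h0 := DFunLike.congr_fun hvw 0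
    have h1 := DFunLike.congr_fun hvw 1
    simp at h0 h1
    exact Prod.ext h0 h1
  simp only [supportIndicator]
  simp_rw [← ite_not (_ = (0 : ℝ))]
  rw [← Finset.sum_filter, Finset.sum_const, nsmul_one, Nat.cast_le,
    ← Finset.card_image_of_injective _ hinj]
  refine Finset.card_le_card fun x hx => ?_
  obtain ⟨v, hv, rfl⟩ := Finset.mem_image.1 hx
  exact MvPolynomial.mem_support_iff.2 (Finset.mem_filter.1 hv).2

theorem eq_single_add_single (x : Fin 2 →₀ ℕ) :
    x = Finsupp.single 0 (x 0) + Finsupp.single 1 (x 1) := by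
  ext i
  fin_cases i <;> simp

theorem coeffXY_eq_zero_of_totalDegree_lt {p : MvPolynomial (Fin 2) ℝ} {a b : ℕ}
    (h : p.totalDegree < a + b) : coeffXY p a b = 0 := by
  apply MvPolynomial.coeff_eq_zero_of_totalDegree_lt
  rw [← Finsupp.degree_apply]
  simpa using h

/-- A polynomial that is `1` on the line `x + y = 1` is `1` modulo `x + y - 1`. -/
theorem exists_quotient {p : MvPolynomial (Fin 2) ℝ}
    (h : ∀ x y : ℝ, x + y = 1 → MvPolynomial.eval ![x, y] p = 1) :
    ∃ q, p = 1 + (X 0 + X 1 - 1) * q := by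
  set l : MvPolynomial (Fin 2) ℝ := X 0 + X 1 - 1 with hl
  -- Substituting `y = 1 - x` sends `p` to `1`, yet is the identity modulo `l`; hence `l` divides `1
  -- - p`.
  set φ : MvPolynomial (Fin 2) ℝ →ₐ[ℝ] MvPolynomial (Fin 2) ℝ := aeval ![X 0, 1 - X 0] with hφ
  have hφp : φ p = 1 := by
    apply MvPolynomial.funext
    intro x
    rw [map_one, ← h (x 0) (1 - x 0) (by ring)]
    have hcomp : (aeval x).comp φ = aeval (R := ℝ) ![x 0, 1 - x 0] := by
      apply MvPolynomial.algHom_ext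
      intro i
      fin_cases i <;> simp [hφ]
    simpa [MvPolynomial.coe_aeval_eq_eval] using DFunLike.congr_fun hcomp p
  have hmk : (Ideal.Quotient.mkₐ ℝ (Ideal.span {l})).comp φ =
      Ideal.Quotient.mkₐ ℝ (Ideal.span {l}) := by
    apply MvPolynomial.algHom_ext
    intro i
    fin_cases i
    · simp [hφ]
    · simp only [hφ, AlgHom.comp_apply, Ideal.Quotient.mkₐ_eq_mk]
      rw [Ideal.Quotient.eq, Ideal.mem_span_singleton]
      exact ⟨-1, by simp [hl]; ring⟩
  have h1 := DFunLike.congr_fun hmk p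
  rw [AlgHom.comp_apply, hφp, Ideal.Quotient.mkₐ_eq_mk, Ideal.Quotient.eq,
    Ideal.mem_span_singleton] at h1
  obtain ⟨q, hq⟩ := h1
  exact ⟨-q, by linear_combination -hq⟩

theorem coeffXY_one_add_mul (q : MvPolynomial (Fin 2) ℝ) {a b : ℕ} (hab : 0 < a + b) :
    coeffXY (1 + (X 0 + X 1 - 1) * q) a b =
      (if a = 0 then 0 else coeffXY q (a - 1) b) + (if b = 0 then 0 else coeffXY q a (b - 1))
      - coeffXY q a b := by
  have h1 : coeffXY (1 : MvPolynomial (Fin 2) ℝ) a b = 0 := by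
    apply coeffXY_eq_zero_of_totalDegree_lt
    rwa [MvPolynomial.totalDegree_one]
  have h2 : coeffXY (X 0 * q) a b = if a = 0 then 0 else coeffXY q (a - 1) b := by
    rcases a with _ | a
    · simp [coeffXY, MvPolynomial.coeff_X_mul']
    · rw [coeffXY, show (Finsupp.single 0 (a + 1) + Finsupp.single 1 b : Fin 2 →₀ ℕ) =
        Finsupp.single 0 1 + (Finsupp.single 0 a + Finsupp.single 1 b) by
          rw [← add_assoc, ← Finsupp.single_add, add_comm a], MvPolynomial.coeff_X_mul]
      simp [coeffXY]
  have h3 : coeffXY (X 1 * q) a b = if b = 0 then 0 else coeffXY q a (b - 1) := by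
    rcases b with _ | b
    · simp [coeffXY, MvPolynomial.coeff_X_mul']
    · rw [coeffXY, show (Finsupp.single 0 a + Finsupp.single 1 (b + 1) : Fin 2 →₀ ℕ) =
        Finsupp.single 1 1 + (Finsupp.single 0 a + Finsupp.single 1 b) by
          rw [Finsupp.single_add]; abel, MvPolynomial.coeff_X_mul]
      simp [coeffXY]
  rw [← h2, ← h3]
  simp only [coeffXY] at h1
  simp only [coeffXY, sub_mul, add_mul, one_mul, MvPolynomial.coeff_add, MvPolynomial.coeff_sub,
    h1, zero_add]

theorem isQuotientPair_of_memH {m : ℕ} {p q : MvPolynomial (Fin 2) ℝ} (hp : MemH (m + 2) p)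
    (hq : p = 1 + (X 0 + X 1 - 1) * q) : IsQuotientPair m (coeffXY p) (coeffXY q) := by
  have hcoeff : ∀ {a b : ℕ}, 0 < a + b → _ := coeffXY_one_add_mul q
  rw [← hq] at hcoeff
  have hdeg : q.totalDegree ≤ m + 1 := by
    have hl : coeffXY (X 0 + X 1 - 1) 1 0 ≠ 0 := by
      simp [coeffXY, MvPolynomial.coeff_X, MvPolynomial.coeff_one,
        Finsupp.single_eq_single_iff, eq_comm (a := (0 : Fin 2 →₀ ℕ))]
    have hl0 : (X 0 + X 1 - 1 : MvPolynomial (Fin 2) ℝ) ≠ 0 := by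
      intro h0
      simp [h0, coeffXY] at hl
    have hl1 : 1 ≤ (X 0 + X 1 - 1 : MvPolynomial (Fin 2) ℝ).totalDegree := by
      by_contra hlt
      exact hl (coeffXY_eq_zero_of_totalDegree_lt (by omega))
    have hq0 : q ≠ 0 := by
      rintro rfl
      have := hp.totalDegree_eq
      simp [hq] at this
    have hmul := MvPolynomial.totalDegree_mul_of_isDomain hl0 hq0
    have hsub := MvPolynomial.totalDegree_sub p 1
    rw [hp.totalDegree_eq, MvPolynomial.totalDegree_one, ← eq_sub_of_add_eq' hq.symm, hmul] at hsub
    simp only [zero_le, sup_of_le_left] at hsub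
    omega
  refine ⟨fun a b => hp.coeff_nonneg _, fun a => by simp [hcoeff], fun b => by simp [hcoeff],
    fun a b => by simp [hcoeff], fun a b hab => ?_, ?_⟩
  · exact coeffXY_eq_zero_of_totalDegree_lt (by omega)
  · have hp0 : p ≠ 0 := by
      rintro rfl
      simpa using hp.totalDegree_eq
    obtain ⟨x, hx, hxd⟩ := Finset.exists_mem_eq_sup p.support
      (MvPolynomial.support_nonempty.2 hp0) (fun s => s.sum fun _ e => e)
    refine ⟨x 0, x 1, ?_, ?_⟩
    · have := hp.totalDegree_eq
      rw [MvPolynomial.totalDegree, hxd, Finsupp.sum_fintype _ _ fun _ => rfl,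
        Fin.sum_univ_two] at this
      exact this
    · rw [coeffXY, ← eq_single_add_single]
      exact MvPolynomial.mem_support_iff.1 hx

theorem mainTheorem1 (d : ℕ) (hd : 1 < d) (hodd : Odd d)
    (p : MvPolynomial (Fin 2) ℝ) (hp : MemH d p) (hsharp : IsSharp p) (j k : ℕ) :
    (coeffXY p (j + 1) k = 0 ∧ coeffXY p j (k + 1) = 0) ∨
    (coeffXY p (j + 1) k = 0 ∧ coeffXY p j k = 0) ∨
    (coeffXY p j (k + 1) = 0 ∧ coeffXY p j k = 0) := by
  obtain ⟨m, rfl⟩ : ∃ m, d = m + 2 := ⟨d - 2, by omega⟩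
  obtain ⟨q, hq⟩ := exists_quotient hp.eval_eq_one
  refine (isQuotientPair_of_memH hp hq).pairwise_eq_zero ?_ j k
  have h1 := sum_supportIndicator_coeffXY_le p (triangle (m + 3))
  -- Sharpness reads `2 * N = m + 5`, the bound required of the array.
  have h2 : (m : ℝ) + 2 = 2 * p.support.card - 3 := by
    have h3 := hsharp
    rw [IsSharp, hp.totalDegree_eq] at h3
    exact_mod_cast h3
  linarith
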